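/- **Hypergraphs.** Let $C$ be a set of labels with a rank function $rank: C\to\mathbb N$. A *hypergraph* $G$ over $C$ consists of a finite set $V_G$ of nodes, a finite set $E_G$ of hyperedges, an attachment function $att_G: E_G\to V_G^*$, a labelling $lab_G: E_G\to C$ with $rank(lab_G(e))=|att_G(e)|$ for all $e\in E_G$, and a sequence $ext_G$ of pairwise distinct nodes (the external nodes); $rank(G)=|ext_G|$ and $rank_G(e)=|att_G(e)|$. A node is *isolated* if it is not attached to any hyperedge (even if it is external). **All hypergraphs below, including those inside types, are without isolated nodes,** and isomorphic hypergraphs are identified. For a label $a$ of rank $n$, $a^\bullet$ is the hypergraph with nodes $v_1,\dots,v_n$, external nodes $v_1\dots v_n$ and one hyperedge, labelled $a$, with attachment $v_1\dots v_n$. If $e\in E_G$ and $rank_G(e)=rank(H)$, then $G[e/H]$ is obtained from $G$ by removing $e$, adding a disjoint copy of $H$, and fusing, for each $i$, the $i$-th external node of $H$ with the $i$-th attachment node of $e$. **Types.** Let $Pr$ be a set of primitive types with ranks, and let $\$_d$ ($d\in\mathbb N$) be additional labels with $rank(\$_d)=d$. Types are defined inductively: every $p\in Pr$ is a type; if $N$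 is a type and $D$ is a hypergraph with $rank(D)=rank(N)$ in which exactly one hyperedge, $e_D^\$$, is labelled by some $\$_d$ and all others are labelled by types, then $N\div D$ is a type of rank $d$; if $M$ is a hypergraph labelled by types, then $\times(M)$ is a type of rank $rank(M)$. **The calculus $\mathrm{HL}^{WI}$.** Sequents have the form $H\to A$, where $H$ is a hypergraph labelled by types and $A$ is a type. Derivable sequents are those obtained from the axioms $p^\bullet\to p$ ($p\in Pr$) by the following rules. * $(\div\to)$: if $e\in E_H$ is labelled by $N$, and $E_D=\{e_D^\$,d_1,\dots,d_k\}$, then from $H\to A$ and $H_i\to lab_D(d_i)$ ($i=1,\dots,k$) infer $H[e/D][e_D^\$/(N\div D)^\bullet][d_1/H_1]\dots[d_k/H_k]\to A$. * $(\to\div)$: from $D[e_D^\$/F]\to N$ infer $F\to N\div D$. * $(\times\to)$: if $e\in E_G$ is labelled by $\times(F)$, then from $G[e/F]\to A$ infer $G\to A$. * $(\to\times)$: if $E_M=\{m_1,\dots,m_l\}$, then from $H_i\to lab_M(m_i)$ ($i=1,\dots,l$) infer $M[m_1/H_1]\dots[m_l/H_l]\to\times(M)$. **Theorem.** The cut rule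 is admissible in $\mathrm{HL}^{WI}$: if $\mathrm{HL}^{WI}\vdash H\to A$ and $\mathrm{HL}^{WI}\vdash G\to B$, and $e_0\in E_G$ is a hyperedge with $lab_G(e_0)=A$, then $\mathrm{HL}^{WI}\vdash G[e_0/H]\to B$. (The replacement is defined since $rank(H)=rank(A)$ for every derivable sequent $H\to A$.) -/

import Mathlib

universe u

namespace HLWI

/-- The unlabelled part of a finite hypergraph of rank `n` without isolated nodes: nodes, hyperedges,
the attachment sequence of each hyperedge (its length is `rk e`) and the sequence of `n` distinct
external nodes. Every node, external or not, must be attached to some hyperedge. -/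
structure Shape (n : ℕ) where
  V : Type
  E : Type
  finV : Finite V
  finE : Finite E
  rk : E → ℕ
  att : (e : E) → Fin (rk e) → V
  ext : Fin n → V
  ext_injective : Function.Injective ext
  no_isolated : ∀ w : V, ∃ (e : E) (i : Fin (rk e)), att e i = w

/-- A hypergraph of rank `n` (finite, without isolated nodes) over the ranked label set `L`,
where `L k` is the set of labels of rank `k`. -/
structure Hypergraph (L : ℕ → Type u) (n : ℕ) extends Shape n where
  lab : (e : E) → L (rk e)

/-- A hypergraph `D` of rank `n` (finite, without isolated nodes) in which exactly one hyperedge,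
`dollar`, has the special label `$_d` with `d = rk dollar`, and all the others have labels in `L`. -/
structure DollarGraph (L : ℕ → Type u) (n : ℕ) extends Shape n where
  dollar : E
  lab : (e : E) → e ≠ dollar → L (rk e)

/-- Isomorphism of the unlabelled parts: bijections on nodes and on hyperedges that preserve
attachment sequences and external nodes. -/
structure Shape.Iso {n : ℕ} (S S' : Shape n) where
  onV : S.V ≃ S'.V
  onE : S.E ≃ S'.E
  rk_eq : ∀ e, S'.rk (onE e) = S.rk e
  att_eq : ∀ (e : S.E) (i : Fin (S.rk e)) (j : Fin (S'.rk (onE e))),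
    (i : ℕ) = (j : ℕ) → onV (S.att e i) = S'.att (onE e) j
  ext_eq : ∀ i, onV (S.ext i) = S'.ext i

def Shape.Iso.refl {n : ℕ} (S : Shape n) : Shape.Iso S S where
  onV := Equiv.refl _
  onE := Equiv.refl _
  rk_eq _ := rfl
  att_eq e i j h := by
    have : i = j := Fin.ext h
    subst this
    rfl
  ext_eq _ := rfl

def Shape.Iso.symm {n : ℕ} {S S' : Shape n} (f : Shape.Iso S S') : Shape.Iso S' S where
  onV := f.onV.symm
  onE := f.onE.symm
  rk_eq e := by
    have h := f.rk_eq (f.onE.symm e)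
    rw [Equiv.apply_symm_apply] at h
    exact h.symm
  att_eq e i j h := by
    rw [Equiv.symm_apply_eq]
    obtain ⟨e', rfl⟩ := f.onE.surjective e
    revert j
    rw [Equiv.symm_apply_apply]
    intro j h
    exact (f.att_eq e' j i h.symm).symm
  ext_eq i := by rw [Equiv.symm_apply_eq, f.ext_eq]

def Shape.Iso.trans {n : ℕ} {S S' S'' : Shape n} (f : Shape.Iso S S') (g : Shape.Iso S' S'') :
    Shape.Iso S S'' where
  onV := f.onV.trans g.onV
  onE := f.onE.trans g.onE
  rk_eq e := (g.rk_eq (f.onE e)).trans (f.rk_eq e)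
  att_eq e i j h := by
    have h1 := f.att_eq e i (Fin.cast (f.rk_eq e).symm i) rfl
    have h2 := g.att_eq (f.onE e) (Fin.cast (f.rk_eq e).symm i) j h
    exact (congrArg g.onV h1).trans h2
  ext_eq i := (congrArg g.onV (f.ext_eq i)).trans (g.ext_eq i)

/-- Two hypergraphs are isomorphic if there is an isomorphism that also preserves labels. -/
def Hypergraph.Isomorphic {L : ℕ → Type u} {n : ℕ} (G G' : Hypergraph L n) : Prop :=
  ∃ f : Shape.Iso G.toShape G'.toShape, ∀ e, HEq (G.lab e) (G'.lab (f.onE e))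

/-- Representatives of types: `PreTp Pr n` consists of the representatives of the types of rank `n`
over the family `Pr` of primitive types (`Pr n` are the primitive types of rank `n`).
Types themselves are obtained below by identifying isomorphic hypergraphs. -/
inductive PreTp (Pr : ℕ → Type u) : ℕ → Type (max 1 u)
  | prim {n : ℕ} (p : Pr n) : PreTp Pr n
  | div {n d : ℕ} (N : PreTp Pr n) (S : Shape n) (dollar : S.E) (hd : S.rk dollar = d)
      (lab : (e : S.E) → e ≠ dollar → PreTp Pr (S.rk e)) : PreTp Pr d
  | times {n : ℕ} (S : Shape n) (lab : (e : S.E) → PreTp Pr (S.rk e)) : PreTp Pr n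

/-- The identification of representatives of types that is induced by not distinguishing between
isomorphic hypergraphs, at all levels of nesting. -/
inductive PreTp.Same {Pr : ℕ → Type u} : {m n : ℕ} → PreTp Pr m → PreTp Pr n → Prop
  | prim {n : ℕ} (p : Pr n) : PreTp.Same (.prim p) (.prim p)
  | div {n d d' : ℕ} (N N' : PreTp Pr n) (S S' : Shape n) (dollar : S.E) (dollar' : S'.E)
      (hd : S.rk dollar = d) (hd' : S'.rk dollar' = d')
      (lab : (e : S.E) → e ≠ dollar → PreTp Pr (S.rk e))
      (lab' : (e : S'.E) → e ≠ dollar' → PreTp Pr (S'.rk e))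
      (f : Shape.Iso S S') (hN : PreTp.Same N N') (hdollar : f.onE dollar = dollar')
      (hlab : ∀ e (h : e ≠ dollar) (h' : f.onE e ≠ dollar'),
        PreTp.Same (lab e h) (lab' (f.onE e) h')) :
      PreTp.Same (.div N S dollar hd lab) (.div N' S' dollar' hd' lab')
  | times {n : ℕ} (S S' : Shape n) (lab : (e : S.E) → PreTp Pr (S.rk e))
      (lab' : (e : S'.E) → PreTp Pr (S'.rk e)) (f : Shape.Iso S S')
      (hlab : ∀ e, PreTp.Same (lab e) (lab' (f.onE e))) :
      PreTp.Same (.times S lab) (.times S' lab')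

theorem PreTp.Same.refl {Pr : ℕ → Type u} {n : ℕ} (A : PreTp Pr n) : PreTp.Same A A := by
  induction A with
  | prim p => exact .prim p
  | div N S dollar hd lab ihN ih =>
    exact .div _ _ _ _ _ _ _ _ _ _ (Shape.Iso.refl S) ihN rfl (fun e h _ => ih e h)
  | times S lab ih => exact .times _ _ _ _ (Shape.Iso.refl S) ih

theorem PreTp.Same.symm {Pr : ℕ → Type u} {m n : ℕ} {A : PreTp Pr m} {B : PreTp Pr n}
    (h : PreTp.Same A B) : PreTp.Same B A := by
  induction h with
  | prim p => exact .prim p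
  | div N N' S S' dollar dollar' hd hd' lab lab' f hN hdollar hlab ihN ih =>
    refine .div _ _ _ _ _ _ _ _ _ _ f.symm ihN
      ((Equiv.symm_apply_eq f.onE).2 hdollar.symm) ?_
    intro e h h'
    obtain ⟨e', rfl⟩ := f.onE.surjective e
    have key : ∀ (e'' : S.E) (h'' : e'' ≠ dollar), e'' = e' →
        PreTp.Same (lab' (f.onE e') h) (lab e'' h'') := by
      rintro e'' h'' rfl
      exact ih e'' h'' h
    exact key _ h' (f.onE.symm_apply_apply e')
  | times S S' lab lab' f hlab ih =>
    refine .times _ _ _ _ f.symm ?_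
    intro e
    obtain ⟨e', rfl⟩ := f.onE.surjective e
    have key : ∀ e'' : S.E, e'' = e' → PreTp.Same (lab' (f.onE e')) (lab e'') := by
      rintro e'' rfl
      exact ih e''
    exact key _ (f.onE.symm_apply_apply e')

theorem PreTp.Same.trans {Pr : ℕ → Type u} {m n k : ℕ} {A : PreTp Pr m} {B : PreTp Pr n}
    {C : PreTp Pr k} (h : PreTp.Same A B) (h' : PreTp.Same B C) : PreTp.Same A C := by
  induction h generalizing k with
  | prim p => exact h'
  | div N N' S S' dollar dollar' hd hd' lab lab' f hN hdollar hlab ihN ih =>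
    cases h' with
    | div _ N'' _ S'' _ dollar'' _ hd'' _ lab'' g hN' hdollar' hlab' =>
      refine .div _ _ _ _ _ _ _ _ _ _ (f.trans g) (ihN hN')
        ((congrArg g.onE hdollar).trans hdollar') ?_
      intro e h h'
      have h1 : f.onE e ≠ dollar' := fun hh => h (f.onE.injective (hh.trans hdollar.symm))
      exact ih e h h1 (hlab' (f.onE e) h1 h')
  | times S S' lab lab' f hlab ih =>
    cases h' with
    | times _ S'' _ lab'' g hlab' =>
      exact .times _ _ _ _ (f.trans g) (fun e => ih e (hlab' (f.onE e)))

instance PreTp.setoid (Pr : ℕ → Type u) (n : ℕ) : Setoid (PreTp Pr n) where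
  r A B := PreTp.Same A B
  iseqv := ⟨PreTp.Same.refl, PreTp.Same.symm, PreTp.Same.trans⟩

/-- The types of rank `n`. -/
def Tp (Pr : ℕ → Type u) (n : ℕ) : Type (max 1 u) := Quotient (PreTp.setoid Pr n)

/-- A primitive type. -/
def Tp.prim {Pr : ℕ → Type u} {n : ℕ} (p : Pr n) : Tp Pr n :=
  Quotient.mk _ (.prim p)

/-- The type `N ÷ D`, whose rank is the rank of the `$`-hyperedge of `D`. -/
noncomputable def Tp.div {Pr : ℕ → Type u} {n : ℕ} (N : Tp Pr n) (D : DollarGraph (Tp Pr) n) :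
    Tp Pr (D.rk D.dollar) :=
  Quotient.mk _ (.div (Quotient.out N) D.toShape D.dollar rfl (fun e h => Quotient.out (D.lab e h)))

/-- The type `×(M)`. -/
noncomputable def Tp.times {Pr : ℕ → Type u} {n : ℕ} (M : Hypergraph (Tp Pr) n) : Tp Pr n :=
  Quotient.mk _ (.times M.toShape (fun e => Quotient.out (M.lab e)))

/-- The hypergraph `a^•`: one hyperedge labelled `a`, attached to the external nodes in order. -/
def Hypergraph.handle {L : ℕ → Type u} {n : ℕ} (a : L n) : Hypergraph L n where
  V := Fin n
  E := Unit
  finV := inferInstance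
  finE := inferInstance
  rk _ := n
  att _ i := i
  ext i := i
  ext_injective _ _ h := h
  no_isolated w := ⟨(), w, rfl⟩
  lab _ := a

/-- The nodes of `S` that are not external. -/
def Shape.Internal {k : ℕ} (S : Shape k) : Type := {w : S.V // w ∉ Set.range S.ext}

open Classical in
/-- Fusing the `j`-th external node of `S` with the node `t j` of another hypergraph with node set
`W`: the external node number `j` of `S` becomes `t j`, and all other nodes stay what they are.
(As the external nodes of `S` are distinct, this never identifies two nodes of `W`, so the nodes after
fusion are those of `W` together with the internal nodes of `S`.) -/
noncomputable def Shape.fuse {k : ℕ} (S : Shape k) {W : Type} (t : Fin k → W) (w : S.V) :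
    W ⊕ S.Internal :=
  if h : w ∈ Set.range S.ext then Sum.inl (t h.choose) else Sum.inr ⟨w, h⟩

theorem Shape.fuse_ext {k : ℕ} (S : Shape k) {W : Type} (t : Fin k → W) (j : Fin k) :
    S.fuse t (S.ext j) = Sum.inl (t j) := by
  have h : S.ext j ∈ Set.range S.ext := ⟨j, rfl⟩
  have h2 : h.choose = j := S.ext_injective h.choose_spec
  unfold Shape.fuse
  rw [dif_pos h, h2]

theorem Shape.fuse_internal {k : ℕ} (S : Shape k) {W : Type} (t : Fin k → W) (w : S.Internal) :
    S.fuse t w.1 = Sum.inr w := by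
  unfold Shape.fuse
  rw [dif_neg w.2]
  rfl

/-- `D[e/F]`, where `e` is the `$`-hyperedge of `D`: remove `e`, add `F`, and fuse the `i`-th external
node of `F` with the `i`-th attachment node of `e`. -/
noncomputable def DollarGraph.plug {L : ℕ → Type u} {n : ℕ} (D : DollarGraph L n)
    (F : Hypergraph L (D.rk D.dollar)) : Hypergraph L n where
  V := D.V ⊕ F.Internal
  E := {e : D.E // e ≠ D.dollar} ⊕ F.E
  finV := by
    have := D.finV
    have := F.finV
    unfold Shape.Internal
    infer_instance
  finE := by
    have := D.finE
    have := F.finE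
    infer_instance
  rk := Sum.elim (fun e => D.rk e.1) F.rk
  att
    | Sum.inl e => fun i => Sum.inl (D.att e.1 i)
    | Sum.inr f => fun i => F.fuse (D.att D.dollar) (F.att f i)
  ext i := Sum.inl (D.ext i)
  ext_injective _ _ h := D.ext_injective (Sum.inl_injective h)
  no_isolated := by
    rintro (w | w)
    · obtain ⟨e, i, rfl⟩ := D.no_isolated w
      by_cases he : e = D.dollar
      · subst he
        obtain ⟨f, j, hf⟩ := F.no_isolated (F.ext i)
        exact ⟨Sum.inr f, j, (congrArg _ hf).trans (F.fuse_ext _ i)⟩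
      · exact ⟨Sum.inl ⟨e, he⟩, i, rfl⟩
    · obtain ⟨f, j, hf⟩ := F.no_isolated w.1
      exact ⟨Sum.inr f, j, (congrArg _ hf).trans (F.fuse_internal _ w)⟩
  lab
    | Sum.inl e => D.lab e.1 e.2
    | Sum.inr f => F.lab f

/-- Relabel the hyperedge `e` of `G` by `$`. -/
def Hypergraph.toDollar {L : ℕ → Type u} {n : ℕ} (G : Hypergraph L n) (e : G.E) :
    DollarGraph L n where
  toShape := G.toShape
  dollar := e
  lab e' _ := G.lab e'

/-- The replacement `G[e/H]`; it requires that the rank of `H` be the rank of `e`. -/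
noncomputable def Hypergraph.replace {L : ℕ → Type u} {n : ℕ} (G : Hypergraph L n) (e : G.E)
    (H : Hypergraph L (G.rk e)) : Hypergraph L n :=
  (G.toDollar e).plug H

/-- `M[e₁/K₁]…[eₗ/Kₗ]`, where `e₁, …, eₗ` are all the hyperedges of `M`: every hyperedge `e` is removed,
a copy of `K e` is added for it, and the `i`-th external node of `K e` is fused with the `i`-th
attachment node of `e`. (Replacements of different hyperedges do not interfere, so they are
carried out at once. A hyperedge `e` is left as it is by taking for `K e` the hypergraph `a^•`,
where `a` is the label of `e`.) -/
noncomputable def Hypergraph.replaceAll {L : ℕ → Type u} {n : ℕ} (M : Hypergraph L n)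
    (K : (e : M.E) → Hypergraph L (M.rk e)) : Hypergraph L n where
  V := M.V ⊕ (Σ e : M.E, (K e).Internal)
  E := Σ e : M.E, (K e).E
  finV := by
    have := M.finV
    have := M.finE
    have := fun e => (K e).finV
    unfold Shape.Internal
    infer_instance
  finE := by
    have := M.finE
    have := fun e => (K e).finE
    infer_instance
  rk f := (K f.1).rk f.2
  att f i := Sum.map id (Sigma.mk f.1) ((K f.1).fuse (M.att f.1) ((K f.1).att f.2 i))
  ext i := Sum.inl (M.ext i)
  ext_injective _ _ h := M.ext_injective (Sum.inl_injective h)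
  no_isolated := by
    rintro (w | ⟨e, w⟩)
    · obtain ⟨e, i, rfl⟩ := M.no_isolated w
      obtain ⟨f, j, hf⟩ := (K e).no_isolated ((K e).ext i)
      exact ⟨⟨e, f⟩, j, by simp [hf, Shape.fuse_ext]⟩
    · obtain ⟨f, j, hf⟩ := (K e).no_isolated w.1
      exact ⟨⟨e, f⟩, j, by simp [hf, Shape.fuse_internal]⟩
  lab f := (K f.1).lab f.2

/-- `D[e/T^•][d₁/K₁]…[dₖ/Kₖ]`, where `e` is the `$`-hyperedge of `D` and `d₁, …, dₖ` are the others. -/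
noncomputable def DollarGraph.fill {L : ℕ → Type u} {n : ℕ} (D : DollarGraph L n)
    (T : L (D.rk D.dollar)) (K : (e : D.E) → e ≠ D.dollar → Hypergraph L (D.rk e)) :
    Hypergraph L n :=
  (D.plug (Hypergraph.handle T)).replaceAll fun
    | Sum.inl e => K e.1 e.2
    | Sum.inr _ => Hypergraph.handle T

/-- Derivability of the sequent `H → A` in the hypergraph Lambek calculus without isolated nodes.
The ranks of antecedent and succedent agree in all derivable sequents, which is built into the
indices. -/
inductive Derivable {Pr : ℕ → Type u} :
    {n : ℕ} → Hypergraph (Tp Pr) n → Tp Pr n → Prop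
  /-- Isomorphic hypergraphs are not distinguished. -/
  | iso {n : ℕ} {H H' : Hypergraph (Tp Pr) n} {A : Tp Pr n} :
      H.Isomorphic H' → Derivable H A → Derivable H' A
  /-- The axiom `p^• → p`. -/
  | ax {n : ℕ} (p : Pr n) : Derivable (Hypergraph.handle (Tp.prim p)) (Tp.prim p)
  /-- Rule `(÷ →)`. The antecedent of the conclusion is `H[e/D][e$/(N÷D)^•][d₁/K₁]…[dₖ/Kₖ]`,
  which is the same as `H[e/D']` with `D' = D[e$/(N÷D)^•][d₁/K₁]…[dₖ/Kₖ]`. -/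
  | div_left {m : ℕ} {H : Hypergraph (Tp Pr) m} {A : Tp Pr m} (e : H.E) (N : Tp Pr (H.rk e))
      (D : DollarGraph (Tp Pr) (H.rk e))
      (K : (d : D.E) → d ≠ D.dollar → Hypergraph (Tp Pr) (D.rk d)) :
      H.lab e = N → Derivable H A → (∀ d hd, Derivable (K d hd) (D.lab d hd)) →
      Derivable (H.replace e (D.fill (Tp.div N D) K)) A
  /-- Rule `(→ ÷)`. -/
  | div_right {n : ℕ} (N : Tp Pr n) (D : DollarGraph (Tp Pr) n)
      (F : Hypergraph (Tp Pr) (D.rk D.dollar)) :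
      Derivable (D.plug F) N → Derivable F (Tp.div N D)
  /-- Rule `(× →)`. -/
  | times_left {m : ℕ} {G : Hypergraph (Tp Pr) m} {A : Tp Pr m} (e : G.E)
      (F : Hypergraph (Tp Pr) (G.rk e)) :
      G.lab e = Tp.times F → Derivable (G.replace e F) A → Derivable G A
  /-- Rule `(→ ×)`. -/
  | times_right {n : ℕ} (M : Hypergraph (Tp Pr) n)
      (K : (e : M.E) → Hypergraph (Tp Pr) (M.rk e)) :
      (∀ e, Derivable (K e) (M.lab e)) → Derivable (M.replaceAll K) (Tp.times M)

end HLWI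

/-!
The proof of cut admissibility is semantic. Every type `A` is interpreted as a set `A.Sem` of
hypergraphs, and the following two facts together give the theorem.

* `Tp.sem_handle` and `Tp.derivable_of_sem`: `A^•` lies in `A.Sem`, and `H → A` is derivable for
  every `H` in `A.Sem`.
* `Derivable.sem_replaceAll` (soundness): if `G → B` is derivable and every hyperedge `e` of `G` is
  replaced by a member of the interpretation of its label, then the result lies in `B.Sem`.

Indeed, replacing every hyperedge of `H` by its own handle shows that a derivable `H → A` has `H` in
`A.Sem`. Replacing `e₀` by `H` and all the other hyperedges of `G` by their handles then shows
that `G[e₀/H]` lies in `B.Sem`, so that `G[e₀/H] → B` is derivable.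

Call a set of hypergraphs left-closed (`LeftClosed`) if it is invariant under isomorphism and under
the two left rules of the calculus. A primitive type `p` is interpreted by the antecedents of `p`;
the type `N ÷ D` by those `F` for which `D[$/F][d₁/K₁]…[dₖ/Kₖ]` lies in the interpretation of `N`
whenever each `Kᵢ` lies in that of the label of `dᵢ`; and `×(M)` by the least left-closed set that
contains all `M[m₁/K₁]…[mₗ/Kₗ]` with `Kᵢ` in the interpretation of the label of `mᵢ`. All these
sets are left-closed, since rewriting inside a component commutes with grafting the component
(`Shape.graft_replace`). The first fact is an induction on `A`, in which the right rules give
`A.Sem ⊆ {H | H → A}` and closure under the left rules gives `A^• ∈ A.Sem`. Soundness is an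
induction on derivations; as all hyperedges are replaced at once, no case distinction on the place
of a cut is needed.

What remains is the calculus of replacement up to isomorphism: simultaneous replacement is
associative and unital, and compatible with the replacement of a single hyperedge. Ranks and labels
match on the nose in nearly all of these isomorphisms, so it suffices to give the maps on nodes and
hyperedges and to check attachments, where each node of a component is either external or internal.
-/

namespace HLWI

/-! ### Isomorphisms of hypergraphs -/

section Replacement

variable {L : ℕ → Type u}

theorem Shape.ext_or_internal {k : ℕ} (S : Shape k) (w : S.V) :
    (∃ j, w = S.ext j) ∨ ∃ x : S.Internal, w = x.1 := by
  by_cases h : w ∈ Set.range S.ext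
  · obtain ⟨j, rfl⟩ := h
    exact .inl ⟨j, rfl⟩
  · exact .inr ⟨⟨w, h⟩, rfl⟩

theorem Shape.Internal.ne_ext {k : ℕ} {S : Shape k} (x : S.Internal) (j : Fin k) :
    x.1 ≠ S.ext j := fun h => x.2 ⟨j, h.symm⟩

/-- An isomorphism from maps on nodes and hyperedges. Surjectivity on nodes is automatic, as every
node of `G'` is attached to some hyperedge. -/
theorem Hypergraph.Isomorphic.of_maps {n : ℕ} {G G' : Hypergraph L n} (v : G.V → G'.V)
    (ε : G.E → G'.E) (hv : Function.Injective v) (hε : Function.Bijective ε)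
    (hrk : ∀ e, G'.rk (ε e) = G.rk e)
    (hatt : ∀ e i, v (G.att e i) = G'.att (ε e) (Fin.cast (hrk e).symm i))
    (hext : ∀ i, v (G.ext i) = G'.ext i) (hlab : ∀ e, HEq (G.lab e) (G'.lab (ε e))) :
    G.Isomorphic G' := by
  have hs : Function.Surjective v := by
    intro w
    obtain ⟨e', i, rfl⟩ := G'.no_isolated w
    obtain ⟨e, rfl⟩ := hε.2 e'
    exact ⟨G.att e (Fin.cast (hrk e) i), hatt _ _⟩
  refine ⟨⟨Equiv.ofBijective v ⟨hv, hs⟩, Equiv.ofBijective ε hε, hrk, ?_, hext⟩, hlab⟩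
  intro e i j h
  have : j = Fin.cast (hrk e).symm i := Fin.ext h.symm
  subst this
  exact hatt e i

theorem Hypergraph.Isomorphic.refl {n : ℕ} (G : Hypergraph L n) : G.Isomorphic G :=
  ⟨Shape.Iso.refl _, fun _ => HEq.rfl⟩

theorem Hypergraph.Isomorphic.symm {n : ℕ} {G G' : Hypergraph L n} (h : G.Isomorphic G') :
    G'.Isomorphic G := by
  obtain ⟨f, hf⟩ := h
  refine ⟨f.symm, fun e => ?_⟩
  obtain ⟨e, rfl⟩ := f.onE.surjective e
  have : f.symm.onE (f.onE e) = e := f.onE.symm_apply_apply e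
  rw [this]
  exact (hf e).symm

theorem Hypergraph.Isomorphic.trans {n : ℕ} {G G' G'' : Hypergraph L n} (h : G.Isomorphic G')
    (h' : G'.Isomorphic G'') : G.Isomorphic G'' := by
  obtain ⟨f, hf⟩ := h
  obtain ⟨g, hg⟩ := h'
  exact ⟨f.trans g, fun e => (hf e).trans (hg (f.onE e))⟩

/-! ### Nodes of attachments after replacement -/

theorem Shape.fuse_injective {k : ℕ} (S : Shape k) {W : Type} {t : Fin k → W}
    (ht : Function.Injective t) : Function.Injective (S.fuse t) := by
  intro w w' h
  obtain ⟨j, rfl⟩ | ⟨x, rfl⟩ := S.ext_or_internal w <;>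
  obtain ⟨j', rfl⟩ | ⟨x', rfl⟩ := S.ext_or_internal w' <;>
  simp only [Shape.fuse_ext, Shape.fuse_internal] at h
  · rw [ht (Sum.inl_injective h)]
  · cases h
  · cases h
  · rw [Sum.inr_injective h]

theorem Hypergraph.replaceAll_att_of_ext {n : ℕ} (M : Hypergraph L n)
    (K : (e : M.E) → Hypergraph L (M.rk e)) (p : (M.replaceAll K).E) (i) {j}
    (h : (K p.1).att p.2 i = (K p.1).ext j) :
    (M.replaceAll K).att p i = Sum.inl (M.att p.1 j) := by
  simp [replaceAll, h, Shape.fuse_ext]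

theorem Hypergraph.replaceAll_att_of_internal {n : ℕ} (M : Hypergraph L n)
    (K : (e : M.E) → Hypergraph L (M.rk e)) (p : (M.replaceAll K).E) (i) {x : (K p.1).Internal}
    (h : (K p.1).att p.2 i = x.1) :
    (M.replaceAll K).att p i = Sum.inr ⟨p.1, x⟩ := by
  simp [replaceAll, h, Shape.fuse_internal]

theorem DollarGraph.plug_att_of_ext {n : ℕ} (D : DollarGraph L n)
    (F : Hypergraph L (D.rk D.dollar)) (f : F.E) (i) {j} (h : F.att f i = F.ext j) :
    (D.plug F).att (Sum.inr f) i = Sum.inl (D.att D.dollar j) :=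
  (congrArg _ h).trans (F.fuse_ext _ j)

theorem DollarGraph.plug_att_of_internal {n : ℕ} (D : DollarGraph L n)
    (F : Hypergraph L (D.rk D.dollar)) (f : F.E) (i) {x : F.Internal} (h : F.att f i = x.1) :
    (D.plug F).att (Sum.inr f) i = Sum.inr x :=
  (congrArg _ h).trans (F.fuse_internal _ x)

/-! ### Simultaneous replacement -/

/-- Simultaneous replacement does not depend on the labels of the hypergraph in which it takes
place, and respects isomorphisms of its shape. The components `K e` and `K' (f.onE e)` have ranks
that are equal only propositionally, hence the heterogeneous equality. -/
theorem Hypergraph.replaceAll_isomorphic_of_shape {n : ℕ} {M M' : Hypergraph L n}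
    (f : Shape.Iso M.toShape M'.toShape) (K : (e : M.E) → Hypergraph L (M.rk e))
    (K' : (e : M'.E) → Hypergraph L (M'.rk e)) (hK : ∀ e, HEq (K e) (K' (f.onE e))) :
    (M.replaceAll K).Isomorphic (M'.replaceAll K') := by
  -- Once the rank function of `M` is that of `M'` composed with the bijection on hyperedges, the
  -- two families of components have the same types and can be identified.
  obtain ⟨⟨V, E, finV, finE, rk, att, ext, ext_inj, no_iso⟩, lab⟩ := M
  obtain ⟨onV, onE, rk_eq, att_eq, ext_eq⟩ := f
  dsimp only at onV onE rk_eq att_eq ext_eq K hK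
  obtain rfl : (fun e => M'.rk (onE e)) = rk := funext rk_eq
  obtain rfl : K = fun e => K' (onE e) := funext fun e => eq_of_heq (hK e)
  refine .of_maps (Sum.map onV (Sigma.map onE fun _ => id)) (Sigma.map onE fun _ => id)
    ?_ ⟨?_, ?_⟩ (fun _ => rfl) ?_ ?_ (fun _ => HEq.rfl)
  · exact onV.injective.sumMap (onE.injective.sigma_map fun _ => Function.injective_id)
  · exact onE.injective.sigma_map fun _ => Function.injective_id
  · exact onE.surjective.sigma_map fun _ => Function.surjective_id
  · rintro ⟨e, f⟩ i
    obtain ⟨j, h⟩ | ⟨x, h⟩ := (K' (onE e)).ext_or_internal ((K' (onE e)).att f i)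
    · refine (congrArg _ (replaceAll_att_of_ext _ (fun e => K' (onE e)) ⟨e, f⟩ i h)).trans ?_
      refine .trans ?_ (M'.replaceAll_att_of_ext K' ⟨onE e, f⟩ i h).symm
      exact congrArg Sum.inl (att_eq e j j rfl)
    · refine (congrArg _ (replaceAll_att_of_internal _ (fun e => K' (onE e)) ⟨e, f⟩ i h)).trans ?_
      exact (M'.replaceAll_att_of_internal K' ⟨onE e, f⟩ i h).symm
  · intro i
    simp [Hypergraph.replaceAll, ext_eq]

/-- `a^•` is a right unit for replacement. -/
theorem Hypergraph.replaceAll_handle {n : ℕ} (M : Hypergraph L n) :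
    (M.replaceAll fun e => handle (M.lab e)).Isomorphic M := by
  refine Isomorphic.symm (.of_maps Sum.inl (fun e => ⟨e, ()⟩) Sum.inl_injective ⟨?_, ?_⟩
    (fun _ => rfl) ?_ (fun _ => rfl) (fun _ => HEq.rfl))
  · intro e e' h
    exact congrArg Sigma.fst h
  · rintro ⟨e, ⟨⟩⟩
    exact ⟨e, rfl⟩
  · intro e i
    exact (M.replaceAll_att_of_ext (fun e => handle (M.lab e)) ⟨e, ()⟩ i (j := i) rfl).symm

/-- `a^•` is a left unit for replacement. -/
theorem Hypergraph.handle_replaceAll {n : ℕ} (a : L n)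
    (K : (e : (handle a).E) → Hypergraph L ((handle a).rk e)) :
    ((handle a).replaceAll K).Isomorphic (K ()) := by
  refine Isomorphic.symm (.of_maps
    (fun w => Sum.map id (Sigma.mk ()) ((K ()).fuse ((handle a).att ()) w))
    (fun f => ⟨(), f⟩) ?_ ⟨?_, ?_⟩ (fun _ => rfl) (fun _ _ => rfl) ?_ (fun _ => HEq.rfl))
  · exact (Function.injective_id.sumMap sigma_mk_injective).comp
      ((K ()).fuse_injective fun _ _ h => h)
  · rintro f f' h
    cases h; rfl
  · rintro ⟨⟨⟩, f⟩
    exact ⟨f, rfl⟩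
  · intro i
    exact congrArg (Sum.map id _) ((K ()).fuse_ext _ i)

/-- Associativity of simultaneous replacement. -/
theorem Hypergraph.replaceAll_replaceAll {n : ℕ} (M : Hypergraph L n)
    (K : (e : M.E) → Hypergraph L (M.rk e))
    (J : (f : (M.replaceAll K).E) → Hypergraph L ((M.replaceAll K).rk f)) :
    ((M.replaceAll K).replaceAll J).Isomorphic
      (M.replaceAll fun e => (K e).replaceAll fun f => J ⟨e, f⟩) := by
  let KJ (e : M.E) : Hypergraph L (M.rk e) := (K e).replaceAll fun f => J ⟨e, f⟩
  let v : ((M.replaceAll K).replaceAll J).V →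
      (M.replaceAll fun e => (K e).replaceAll fun f => J ⟨e, f⟩).V
    | .inl (.inl w) => .inl w
    | .inl (.inr ⟨e, x⟩) => .inr ⟨e, ⟨.inl x.1, by
        rintro ⟨j, hj⟩
        exact x.ne_ext j (Sum.inl_injective hj).symm⟩⟩
    | .inr ⟨⟨e, f⟩, x⟩ => .inr ⟨e, ⟨.inr ⟨f, x⟩, by
        rintro ⟨j, hj⟩
        cases hj⟩⟩
  refine .of_maps v (fun p => ⟨p.1.1, p.1.2, p.2⟩) ?_ ⟨?_, ?_⟩ (fun _ => rfl) ?_ (fun _ => rfl)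
    (fun _ => HEq.rfl)
  · rintro ((w | ⟨e, ⟨x, hx⟩⟩) | ⟨⟨e, f⟩, x⟩)
      ((w' | ⟨e', ⟨x', hx'⟩⟩) | ⟨⟨e', f'⟩, x'⟩) h <;> cases h <;> rfl
  · rintro ⟨⟨e, f⟩, g⟩ ⟨⟨e', f'⟩, g'⟩ h
    cases h; rfl
  · rintro ⟨e, f, g⟩
    exact ⟨⟨⟨e, f⟩, g⟩, rfl⟩
  · rintro ⟨⟨e, f⟩, g⟩ i
    obtain ⟨j, h⟩ | ⟨x, h⟩ := (J ⟨e, f⟩).ext_or_internal ((J ⟨e, f⟩).att g i)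
    · have h1 := (K e).replaceAll_att_of_ext (fun f => J ⟨e, f⟩) ⟨f, g⟩ i h
      refine (congrArg v ((M.replaceAll K).replaceAll_att_of_ext J ⟨⟨e, f⟩, g⟩ i h)).trans ?_
      obtain ⟨k, h'⟩ | ⟨y, h'⟩ := (K e).ext_or_internal ((K e).att f j)
      · refine (congrArg (v ∘ .inl) (M.replaceAll_att_of_ext K ⟨e, f⟩ j h')).trans ?_
        exact (M.replaceAll_att_of_ext KJ ⟨e, f, g⟩ i (h1.trans (congrArg Sum.inl h'))).symm
      · refine (congrArg (v ∘ .inl) (M.replaceAll_att_of_internal K ⟨e, f⟩ j h')).trans ?_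
        exact (M.replaceAll_att_of_internal KJ ⟨e, f, g⟩ i
          (x := ⟨.inl y.1, _⟩) (h1.trans (congrArg Sum.inl h'))).symm
    · have h1 := (K e).replaceAll_att_of_internal (fun f => J ⟨e, f⟩) ⟨f, g⟩ i h
      refine (congrArg v ((M.replaceAll K).replaceAll_att_of_internal J ⟨⟨e, f⟩, g⟩ i h)).trans ?_
      exact (M.replaceAll_att_of_internal KJ ⟨e, f, g⟩ i (x := ⟨.inr ⟨f, x⟩, _⟩) h1).symm

/-! ### Grafting a hypergraph at a distinguished hyperedge -/

/-- `S[s/X][e₁/K₁]…[eₖ/Kₖ]`, where `e₁, …, eₖ` are the hyperedges of `S` other than `s`. This is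
`Hypergraph.replaceAll` with the hyperedge `s` singled out, so that the hyperedges and
internal nodes of `X` form a summand of their own and no transport along `e = s` is needed. -/
noncomputable def Shape.graft {n : ℕ} (S : Shape n) (s : S.E) (X : Hypergraph L (S.rk s))
    (K : (e : S.E) → e ≠ s → Hypergraph L (S.rk e)) : Hypergraph L n where
  V := (S.V ⊕ X.Internal) ⊕ (Σ e : {e : S.E // e ≠ s}, (K e.1 e.2).Internal)
  E := X.E ⊕ (Σ e : {e : S.E // e ≠ s}, (K e.1 e.2).E)
  finV := by
    have := S.finV
    have := S.finE
    have := X.finV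
    have := fun e : {e : S.E // e ≠ s} => (K e.1 e.2).finV
    unfold Shape.Internal
    infer_instance
  finE := by
    have := S.finE
    have := X.finE
    have := fun e : {e : S.E // e ≠ s} => (K e.1 e.2).finE
    infer_instance
  rk := Sum.elim X.rk (fun p => (K p.1.1 p.1.2).rk p.2)
  att
    | Sum.inl f => fun i => Sum.inl (X.fuse (S.att s) (X.att f i))
    | Sum.inr p => fun i => Sum.map Sum.inl (Sigma.mk p.1)
        ((K p.1.1 p.1.2).fuse (S.att p.1.1) ((K p.1.1 p.1.2).att p.2 i))
  ext i := Sum.inl (Sum.inl (S.ext i))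
  ext_injective _ _ h := S.ext_injective (Sum.inl_injective (Sum.inl_injective h))
  no_isolated := by
    rintro ((w | w) | ⟨e, w⟩)
    · obtain ⟨e, i, rfl⟩ := S.no_isolated w
      by_cases he : e = s
      · subst he
        obtain ⟨f, j, hf⟩ := X.no_isolated (X.ext i)
        exact ⟨.inl f, j, congrArg Sum.inl ((congrArg _ hf).trans (X.fuse_ext _ i))⟩
      · obtain ⟨f, j, hf⟩ := (K e he).no_isolated ((K e he).ext i)
        exact ⟨.inr ⟨⟨e, he⟩, f⟩, j,
          congrArg (Sum.map _ _) ((congrArg _ hf).trans ((K e he).fuse_ext _ i))⟩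
    · obtain ⟨f, j, hf⟩ := X.no_isolated w.1
      exact ⟨.inl f, j, congrArg Sum.inl ((congrArg _ hf).trans (X.fuse_internal _ w))⟩
    · obtain ⟨f, j, hf⟩ := (K e.1 e.2).no_isolated w.1
      exact ⟨.inr ⟨e, f⟩, j,
        congrArg (Sum.map _ _) ((congrArg _ hf).trans ((K e.1 e.2).fuse_internal _ w))⟩
  lab
    | Sum.inl f => X.lab f
    | Sum.inr p => (K p.1.1 p.1.2).lab p.2

section graft

variable {n : ℕ} (S : Shape n) (s : S.E) (X : Hypergraph L (S.rk s))
    (K : (e : S.E) → e ≠ s → Hypergraph L (S.rk e))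

theorem Shape.graft_att_inl_of_ext (f : X.E) (i) {j} (h : X.att f i = X.ext j) :
    (S.graft s X K).att (.inl f) i = .inl (.inl (S.att s j)) :=
  congrArg Sum.inl ((congrArg _ h).trans (X.fuse_ext _ j))

theorem Shape.graft_att_inl_of_internal (f : X.E) (i) {x : X.Internal} (h : X.att f i = x.1) :
    (S.graft s X K).att (.inl f) i = .inl (.inr x) :=
  congrArg Sum.inl ((congrArg _ h).trans (X.fuse_internal _ x))

theorem Shape.graft_att_inr_of_ext (e : {e : S.E // e ≠ s}) (f : (K e.1 e.2).E) (i) {j}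
    (h : (K e.1 e.2).att f i = (K e.1 e.2).ext j) :
    (S.graft s X K).att (.inr ⟨e, f⟩) i = .inl (.inl (S.att e.1 j)) :=
  congrArg (Sum.map _ _) ((congrArg _ h).trans ((K e.1 e.2).fuse_ext _ j))

theorem Shape.graft_att_inr_of_internal (e : {e : S.E // e ≠ s}) (f : (K e.1 e.2).E) (i)
    {x : (K e.1 e.2).Internal} (h : (K e.1 e.2).att f i = x.1) :
    (S.graft s X K).att (.inr ⟨e, f⟩) i = .inr ⟨e, x⟩ :=
  congrArg (Sum.map _ _) ((congrArg _ h).trans ((K e.1 e.2).fuse_internal _ x))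

end graft

theorem Hypergraph.graft_isomorphic_replaceAll {n : ℕ} (M : Hypergraph L n) (s : M.E)
    (K : (e : M.E) → Hypergraph L (M.rk e)) :
    (M.graft s (K s) fun e _ => K e).Isomorphic (M.replaceAll K) := by
  refine .of_maps
    (Sum.elim (Sum.map id fun x => ⟨s, x⟩) fun p => .inr ⟨p.1.1, p.2⟩)
    (Sum.elim (fun f => ⟨s, f⟩) fun p => ⟨p.1.1, p.2⟩) ?_ ⟨?_, ?_⟩ ?_ ?_ (fun _ => rfl) ?_
  · rintro ((w | x) | ⟨⟨e, he⟩, x⟩) ((w' | x') | ⟨⟨e', he'⟩, x'⟩) h <;>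
      first
        | (cases h <;> rfl)
        | exact absurd (congrArg Sigma.fst (Sum.inr_injective h)) he
        | exact absurd (congrArg Sigma.fst (Sum.inr_injective h)).symm he'
  · rintro (f | ⟨⟨e, he⟩, f⟩) (f' | ⟨⟨e', he'⟩, f'⟩) h <;>
      first
        | (cases h <;> rfl)
        | exact absurd (congrArg Sigma.fst h) he
        | exact absurd (congrArg Sigma.fst h).symm he'
  · rintro ⟨e, f⟩
    by_cases he : e = s
    · subst he
      exact ⟨.inl f, rfl⟩
    · exact ⟨.inr ⟨⟨e, he⟩, f⟩, rfl⟩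
  · rintro (f | p) <;> rfl
  · rintro (f | ⟨e, f⟩) i
    · obtain ⟨j, h⟩ | ⟨x, h⟩ := (K s).ext_or_internal ((K s).att f i)
      · exact (congrArg _ (M.graft_att_inl_of_ext s _ _ f i h)).trans
          (M.replaceAll_att_of_ext K ⟨s, f⟩ i h).symm
      · exact (congrArg _ (M.graft_att_inl_of_internal s _ _ f i h)).trans
          (M.replaceAll_att_of_internal K ⟨s, f⟩ i h).symm
    · obtain ⟨j, h⟩ | ⟨x, h⟩ := (K e.1).ext_or_internal ((K e.1).att f i)
      · exact (congrArg _ (M.graft_att_inr_of_ext s _ (fun e _ => K e) e f i h)).trans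
          (M.replaceAll_att_of_ext K ⟨e.1, f⟩ i h).symm
      · exact (congrArg _ (M.graft_att_inr_of_internal s _ (fun e _ => K e) e f i h)).trans
          (M.replaceAll_att_of_internal K ⟨e.1, f⟩ i h).symm
  · rintro (f | p) <;> rfl

/-- Replacing all hyperedges of `D[$/F]` amounts to replacing those of `F` first, and then
grafting the result. -/
theorem DollarGraph.plug_replaceAll {n : ℕ} (D : DollarGraph L n)
    (F : Hypergraph L (D.rk D.dollar))
    (J : (e : (D.plug F).E) → Hypergraph L ((D.plug F).rk e)) :
    ((D.plug F).replaceAll J).Isomorphic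
      (D.graft D.dollar (F.replaceAll fun f => J (.inr f)) fun e he => J (.inl ⟨e, he⟩)) := by
  let K (e : D.E) (he : e ≠ D.dollar) : Hypergraph L (D.rk e) := J (.inl ⟨e, he⟩)
  let FJ : Hypergraph L (D.rk D.dollar) := F.replaceAll fun f => J (.inr f)
  let v : ((D.plug F).replaceAll J).V →
      (D.graft D.dollar (F.replaceAll fun f => J (.inr f)) fun e he => J (.inl ⟨e, he⟩)).V
    | .inl (.inl w) => .inl (.inl w)
    | .inl (.inr x) => .inl (.inr ⟨.inl x.1, by
        rintro ⟨j, hj⟩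
        exact x.ne_ext j (Sum.inl_injective hj).symm⟩)
    | .inr ⟨.inl e, x⟩ => .inr ⟨e, x⟩
    | .inr ⟨.inr f, x⟩ => .inl (.inr ⟨.inr ⟨f, x⟩, by
        rintro ⟨j, hj⟩
        cases hj⟩)
  let ε : ((D.plug F).replaceAll J).E →
      (D.graft D.dollar (F.replaceAll fun f => J (.inr f)) fun e he => J (.inl ⟨e, he⟩)).E
    | ⟨.inl e, g⟩ => .inr ⟨e, g⟩
    | ⟨.inr f, g⟩ => .inl ⟨f, g⟩
  refine .of_maps v ε ?_ ⟨?_, ?_⟩ ?_ ?_ (fun _ => rfl) ?_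
  · rintro ((w | ⟨x, hx⟩) | ⟨e | f, x⟩) ((w' | ⟨x', hx'⟩) | ⟨e' | f', x'⟩) h <;> cases h <;> rfl
  · rintro ⟨e | f, g⟩ ⟨e' | f', g'⟩ h <;> cases h <;> rfl
  · rintro (⟨f, g⟩ | ⟨e, g⟩)
    · exact ⟨⟨.inr f, g⟩, rfl⟩
    · exact ⟨⟨.inl e, g⟩, rfl⟩
  · rintro ⟨e | f, g⟩ <;> rfl
  · rintro ⟨e | f, g⟩ i
    · obtain ⟨j, h⟩ | ⟨x, h⟩ := (J (.inl e)).ext_or_internal ((J (.inl e)).att g i)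
      · exact (congrArg v ((D.plug F).replaceAll_att_of_ext J ⟨.inl e, g⟩ i h)).trans
          (D.graft_att_inr_of_ext D.dollar FJ K e g i h).symm
      · exact (congrArg v ((D.plug F).replaceAll_att_of_internal J ⟨.inl e, g⟩ i h)).trans
          (D.graft_att_inr_of_internal D.dollar FJ K e g i h).symm
    · obtain ⟨j, h⟩ | ⟨x, h⟩ := (J (.inr f)).ext_or_internal ((J (.inr f)).att g i)
      · have h1 := F.replaceAll_att_of_ext (fun f => J (.inr f)) ⟨f, g⟩ i h
        refine (congrArg v ((D.plug F).replaceAll_att_of_ext J ⟨.inr f, g⟩ i h)).trans ?_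
        obtain ⟨k, h'⟩ | ⟨y, h'⟩ := F.ext_or_internal (F.att f j)
        · refine (congrArg (v ∘ .inl) (D.plug_att_of_ext F f j h')).trans ?_
          exact (D.graft_att_inl_of_ext D.dollar FJ K ⟨f, g⟩ i
            (h1.trans (congrArg Sum.inl h'))).symm
        · refine (congrArg (v ∘ .inl) (D.plug_att_of_internal F f j h')).trans ?_
          exact (D.graft_att_inl_of_internal D.dollar FJ K ⟨f, g⟩ i
            (x := ⟨.inl y.1, _⟩) (h1.trans (congrArg Sum.inl h'))).symm
      · have h1 := F.replaceAll_att_of_internal (fun f => J (.inr f)) ⟨f, g⟩ i h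
        refine (congrArg v ((D.plug F).replaceAll_att_of_internal J ⟨.inr f, g⟩ i h)).trans ?_
        exact (D.graft_att_inl_of_internal D.dollar FJ K ⟨f, g⟩ i
          (x := ⟨.inr ⟨f, x⟩, _⟩) h1).symm
  · rintro ⟨e | f, g⟩ <;> rfl

/-- Replacing a hyperedge of the component `X` commutes with grafting `X`. This is what makes
the left-closed sets stable under inverse images of grafting. -/
theorem Shape.graft_replace {n : ℕ} (S : Shape n) (s : S.E) (X : Hypergraph L (S.rk s))
    (K : (e : S.E) → e ≠ s → Hypergraph L (S.rk e)) (f : X.E) (Y : Hypergraph L (X.rk f)) :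
    ((S.graft s X K).replace (.inl f) Y).Isomorphic (S.graft s (X.replace f Y) K) := by
  let v : ((S.graft s X K).replace (.inl f) Y).V → (S.graft s (X.replace f Y) K).V
    | .inl (.inl (.inl w)) => .inl (.inl w)
    | .inl (.inl (.inr x)) => .inl (.inr ⟨.inl x.1, by
        rintro ⟨j, hj⟩
        exact x.ne_ext j (Sum.inl_injective hj).symm⟩)
    | .inl (.inr p) => .inr p
    | .inr y => .inl (.inr ⟨.inr y, by
        rintro ⟨j, hj⟩
        cases hj⟩)
  let ε : ((S.graft s X K).replace (.inl f) Y).E → (S.graft s (X.replace f Y) K).E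
    | .inl ⟨.inl g, hg⟩ => .inl (.inl ⟨g, fun h => hg (congrArg Sum.inl h)⟩)
    | .inl ⟨.inr p, _⟩ => .inr p
    | .inr g => .inl (.inr g)
  refine .of_maps v ε ?_ ⟨?_, ?_⟩ ?_ ?_ (fun _ => rfl) ?_
  · rintro (((w | ⟨x, hx⟩) | p) | y) (((w' | ⟨x', hx'⟩) | p') | y') h <;> cases h <;> rfl
  · rintro (⟨g | p, hg⟩ | g) (⟨g' | p', hg'⟩ | g') h <;> cases h <;> rfl
  · rintro ((⟨g, hg⟩ | g) | p)
    · exact ⟨.inl ⟨.inl g, fun h => hg (Sum.inl_injective h)⟩, rfl⟩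
    · exact ⟨.inr g, rfl⟩
    · exact ⟨.inl ⟨.inr p, Sum.inr_ne_inl⟩, rfl⟩
  · rintro (⟨g | p, hg⟩ | g) <;> rfl
  · -- Hyperedges of `X` and those of `Y` attached to an external node of `Y` both end up at a node
    -- of `X`, whose position after grafting is computed here.
    have key : ∀ (g : X.E) (i) (w : (X.replace f Y).V) (g' : (X.replace f Y).E) (i'),
        w = .inl (X.att g i) → (X.replace f Y).att g' i' = w →
        v (.inl ((S.graft s X K).att (.inl g) i)) =
          (S.graft s (X.replace f Y) K).att (.inl g') i' := by
      rintro g i w g' i' rfl hw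
      obtain ⟨k, h⟩ | ⟨y, h⟩ := X.ext_or_internal (X.att g i)
      · exact (congrArg (v ∘ .inl) (S.graft_att_inl_of_ext s X K g i h)).trans
          (S.graft_att_inl_of_ext s _ K g' i' (hw.trans (congrArg Sum.inl h))).symm
      · exact (congrArg (v ∘ .inl) (S.graft_att_inl_of_internal s X K g i h)).trans
          (S.graft_att_inl_of_internal s _ K g' i' (x := ⟨.inl y.1, _⟩)
            (hw.trans (congrArg Sum.inl h))).symm
    rintro (⟨g | ⟨e, g⟩, hg⟩ | g) i
    · exact key g i _ (.inl ⟨g, _⟩) i rfl rfl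
    · obtain ⟨j, h⟩ | ⟨x, h⟩ := (K e.1 e.2).ext_or_internal ((K e.1 e.2).att g i)
      · exact (congrArg (v ∘ .inl) (S.graft_att_inr_of_ext s X K e g i h)).trans
          (S.graft_att_inr_of_ext s _ K e g i h).symm
      · exact (congrArg (v ∘ .inl) (S.graft_att_inr_of_internal s X K e g i h)).trans
          (S.graft_att_inr_of_internal s _ K e g i h).symm
    · obtain ⟨j, h⟩ | ⟨x, h⟩ := Y.ext_or_internal (Y.att g i)
      · refine (congrArg v (((S.graft s X K).toDollar (.inl f)).plug_att_of_ext Y g i h)).trans ?_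
        exact key f j _ (.inr g) i rfl ((X.toDollar f).plug_att_of_ext Y g i h)
      · refine (congrArg v
          (((S.graft s X K).toDollar (.inl f)).plug_att_of_internal Y g i h)).trans ?_
        exact (S.graft_att_inl_of_internal s (X.replace f Y) K (.inr g) i (x := ⟨.inr x, _⟩)
          ((X.toDollar f).plug_att_of_internal Y g i h)).symm
  · rintro (⟨g | p, hg⟩ | g) <;> rfl

/-- The counterpart of `Hypergraph.replaceAll_isomorphic_of_shape` for grafting. It is proved
directly rather than through `Hypergraph.graft_isomorphic_replaceAll`, as a bare shape has no labels. -/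
theorem Shape.graft_isomorphic_of_shape {n : ℕ} {S S' : Shape n} (f : Shape.Iso S S') {s : S.E}
    {s' : S'.E} (hs : f.onE s = s') {X : Hypergraph L (S.rk s)} {X' : Hypergraph L (S'.rk s')}
    (hX : HEq X X') {K : (e : S.E) → e ≠ s → Hypergraph L (S.rk e)}
    {K' : (e : S'.E) → e ≠ s' → Hypergraph L (S'.rk e)}
    (hK : ∀ e h h', HEq (K e h) (K' (f.onE e) h')) :
    (S.graft s X K).Isomorphic (S'.graft s' X' K') := by
  obtain ⟨V, E, finV, finE, rk, att, ext, ext_inj, no_iso⟩ := S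
  obtain ⟨onV, onE, rk_eq, att_eq, ext_eq⟩ := f
  dsimp only at onV onE rk_eq att_eq ext_eq s hs X K hK
  obtain rfl : (fun e => S'.rk (onE e)) = rk := funext rk_eq
  subst hs
  obtain rfl := eq_of_heq hX
  have hne : ∀ e, e ≠ s → onE e ≠ onE s := fun e h => onE.injective.ne h
  obtain rfl : K = fun e h => K' (onE e) (hne e h) :=
    funext fun e => funext fun h => eq_of_heq (hK e h _)
  let S : Shape n := ⟨V, E, finV, finE, fun e => S'.rk (onE e), att, ext, ext_inj, no_iso⟩
  let K (e : E) (h : e ≠ s) : Hypergraph L (S'.rk (onE e)) := K' (onE e) (hne e h)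
  let φ (e : {e : E // e ≠ s}) : {e : S'.E // e ≠ onE s} := ⟨onE e.1, hne e.1 e.2⟩
  have hφ : Function.Bijective φ := by
    refine ⟨fun e e' h => Subtype.ext (onE.injective (congrArg Subtype.val h)), fun e => ?_⟩
    obtain ⟨e', he'⟩ := onE.surjective e.1
    exact ⟨⟨e', fun h => e.2 (he'.symm.trans (congrArg onE h))⟩, Subtype.ext he'⟩
  refine .of_maps (Sum.map (Sum.map onV id) (Sigma.map φ fun _ => id))
    (Sum.map id (Sigma.map φ fun _ => id)) ?_ ⟨?_, ?_⟩ ?_ ?_ ?_ ?_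
  · exact (onV.injective.sumMap Function.injective_id).sumMap
      (hφ.1.sigma_map fun _ => Function.injective_id)
  · exact Function.injective_id.sumMap (hφ.1.sigma_map fun _ => Function.injective_id)
  · exact Function.surjective_id.sumMap (hφ.2.sigma_map fun _ => Function.surjective_id)
  · rintro (g | p) <;> rfl
  · rintro (g | ⟨e, g⟩) i
    · obtain ⟨j, h⟩ | ⟨x, h⟩ := X.ext_or_internal (X.att g i)
      · refine (congrArg _ (S.graft_att_inl_of_ext s X K g i h)).trans ?_
        refine .trans ?_ (S'.graft_att_inl_of_ext (onE s) X K' g i h).symm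
        exact congrArg (Sum.inl ∘ Sum.inl) (att_eq s j j rfl)
      · exact (congrArg _ (S.graft_att_inl_of_internal s X K g i h)).trans
          (S'.graft_att_inl_of_internal (onE s) X K' g i h).symm
    · obtain ⟨j, h⟩ | ⟨x, h⟩ := (K' _ (φ e).2).ext_or_internal ((K' _ (φ e).2).att g i)
      · refine (congrArg _ (S.graft_att_inr_of_ext s X K e g i h)).trans ?_
        refine .trans ?_ (S'.graft_att_inr_of_ext (onE s) X K' (φ e) g i h).symm
        exact congrArg (Sum.inl ∘ Sum.inl) (att_eq e.1 j j rfl)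
      · exact (congrArg _ (S.graft_att_inr_of_internal s X K e g i h)).trans
          (S'.graft_att_inr_of_internal (onE s) X K' (φ e) g i h).symm
  · intro i
    exact congrArg (Sum.inl ∘ Sum.inl) (ext_eq i)
  · rintro (g | p) <;> rfl

/-- A family of hypergraphs can be prescribed separately at `s` and away from `s`. Its members have
types that depend on the hyperedge, so that defining the family takes a transport along `e = s`,
which this statement hides. -/
theorem Hypergraph.exists_extend {n : ℕ} (M : Hypergraph L n) (s : M.E)
    (X : Hypergraph L (M.rk s)) (K : (e : M.E) → e ≠ s → Hypergraph L (M.rk e)) :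
    ∃ J : (e : M.E) → Hypergraph L (M.rk e), J s = X ∧ ∀ e h, J e = K e h := by
  classical
  refine ⟨fun e => if h : e = s then h ▸ X else K e h, ?_, fun e h => ?_⟩
  · simp
  · simp [h]

theorem Shape.graft_congr {n : ℕ} (S : Shape n) (s : S.E) {X X' : Hypergraph L (S.rk s)}
    {K K' : (e : S.E) → e ≠ s → Hypergraph L (S.rk e)} (hX : X.Isomorphic X')
    (hK : ∀ e h, (K e h).Isomorphic (K' e h)) :
    (S.graft s X K).Isomorphic (S.graft s X' K') := by
  obtain ⟨f, hf⟩ := hX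
  choose g hg using hK
  have hint : ∀ {k} {Y Y' : Hypergraph L k} (f : Shape.Iso Y.toShape Y'.toShape) (x : Y.Internal),
      f.onV x.1 ∉ Set.range Y'.ext := by
    rintro k Y Y' f x ⟨j, hj⟩
    rw [← f.ext_eq] at hj
    exact x.ne_ext j (f.onV.injective hj).symm
  let I {k} {Y Y' : Hypergraph L k} (f : Shape.Iso Y.toShape Y'.toShape) (x : Y.Internal) :
    Y'.Internal := ⟨f.onV x.1, hint f x⟩
  have hI : ∀ {k} {Y Y' : Hypergraph L k} (f : Shape.Iso Y.toShape Y'.toShape),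
      Function.Injective (I f) := fun f x y h =>
    Subtype.ext (f.onV.injective (congrArg Subtype.val h))
  refine .of_maps (Sum.map (Sum.map id (I f)) (Sigma.map id fun e => I (g e.1 e.2)))
    (Sum.map f.onE (Sigma.map id fun e => (g e.1 e.2).onE)) ?_ ⟨?_, ?_⟩ ?_ ?_ (fun _ => rfl) ?_
  · exact (Function.injective_id.sumMap (hI f)).sumMap
      (Function.injective_id.sigma_map fun e => hI _)
  · exact f.onE.injective.sumMap
      (Function.injective_id.sigma_map fun e => (g e.1 e.2).onE.injective)
  · exact f.onE.surjective.sumMap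
      (Function.surjective_id.sigma_map fun e => (g e.1 e.2).onE.surjective)
  · rintro (a | ⟨e, a⟩)
    · exact f.rk_eq a
    · exact (g e.1 e.2).rk_eq a
  · rintro (a | ⟨e, a⟩) i
    · have h2 := f.att_eq a i (Fin.cast (f.rk_eq a).symm i) rfl
      obtain ⟨j, h⟩ | ⟨x, h⟩ := X.ext_or_internal (X.att a i)
      · rw [h, f.ext_eq] at h2
        exact (congrArg _ (S.graft_att_inl_of_ext s X K a i h)).trans
          (S.graft_att_inl_of_ext s X' K' _ _ h2.symm).symm
      · rw [h] at h2
        exact (congrArg _ (S.graft_att_inl_of_internal s X K a i h)).trans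
          (S.graft_att_inl_of_internal s X' K' _ _ (x := I f x) h2.symm).symm
    · have h2 := (g e.1 e.2).att_eq a i (Fin.cast ((g e.1 e.2).rk_eq a).symm i) rfl
      obtain ⟨j, h⟩ | ⟨x, h⟩ := (K e.1 e.2).ext_or_internal ((K e.1 e.2).att a i)
      · rw [h, (g e.1 e.2).ext_eq] at h2
        exact (congrArg _ (S.graft_att_inr_of_ext s X K e a i h)).trans
          (S.graft_att_inr_of_ext s X' K' e _ _ h2.symm).symm
      · rw [h] at h2
        exact (congrArg _ (S.graft_att_inr_of_internal s X K e a i h)).trans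
          (S.graft_att_inr_of_internal s X' K' e _ _ (x := I (g e.1 e.2) x) h2.symm).symm
  · rintro (a | ⟨e, a⟩)
    · exact hf a
    · exact hg e.1 e.2 a

/-! ### Replacement of one hyperedge in terms of grafting -/

theorem DollarGraph.plug_isomorphic_graft {n : ℕ} (D : DollarGraph L n)
    (F : Hypergraph L (D.rk D.dollar)) :
    (D.plug F).Isomorphic (D.graft D.dollar F fun e he => .handle (D.lab e he)) :=
  (D.plug F).replaceAll_handle.symm.trans <| (D.plug_replaceAll F _).trans <|
    D.graft_congr _ F.replaceAll_handle fun _ _ => .refl _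

theorem DollarGraph.fill_isomorphic_graft {n : ℕ} (D : DollarGraph L n)
    (T : L (D.rk D.dollar)) (K : (e : D.E) → e ≠ D.dollar → Hypergraph L (D.rk e)) :
    (D.fill T K).Isomorphic (D.graft D.dollar (.handle T) K) :=
  (D.plug_replaceAll _ _).trans <|
    D.graft_congr _ (Hypergraph.handle_replaceAll T _) fun _ _ => .refl _

theorem Hypergraph.handle_replace {n : ℕ} (a : L n) (X : Hypergraph L n) :
    ((handle a).replace () X).Isomorphic X := by
  refine (((handle a).toDollar ()).plug_isomorphic_graft X).trans <|
    .trans ?_ (handle_replaceAll a fun _ => X)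
  refine .trans ?_ ((handle a).graft_isomorphic_replaceAll () fun _ => X)
  exact Shape.graft_congr _ _ (.refl _) fun _ h => absurd rfl h

theorem DollarGraph.fill_replaceAll {n : ℕ} (D : DollarGraph L n) (T : L (D.rk D.dollar))
    (K : (e : D.E) → e ≠ D.dollar → Hypergraph L (D.rk e))
    (J : (f : (D.fill T K).E) → Hypergraph L ((D.fill T K).rk f)) :
    ((D.fill T K).replaceAll J).Isomorphic
      (D.graft D.dollar (J ⟨.inr (), ()⟩) fun e he =>
        (K e he).replaceAll fun f => J ⟨.inl ⟨e, he⟩, f⟩) :=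
  (Hypergraph.replaceAll_replaceAll _ _ J).trans <| (D.plug_replaceAll _ _).trans <|
    D.graft_congr _ ((Hypergraph.handle_replaceAll T _).trans (Hypergraph.handle_replaceAll T _))
      fun _ _ => .refl _

end Replacement

/-! ### Left-closed sets and the interpretation of types -/

section Semantics

variable {Pr : ℕ → Type u}

/-- A set of hypergraphs is left-closed if it is invariant under isomorphism and under the passage
from the antecedent of the (main) premise to that of the conclusion in the rules `(÷ →)` and
`(× →)`. The side premises of `(÷ →)` have to be derivable. -/
structure LeftClosed {n : ℕ} (C : Hypergraph (Tp Pr) n → Prop) : Prop where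
  iso : ∀ {H H' : Hypergraph (Tp Pr) n}, H.Isomorphic H' → C H → C H'
  div_left : ∀ {H : Hypergraph (Tp Pr) n} (e : H.E) (N : Tp Pr (H.rk e))
    (D : DollarGraph (Tp Pr) (H.rk e))
    (K : (d : D.E) → d ≠ D.dollar → Hypergraph (Tp Pr) (D.rk d)),
    H.lab e = N → C H → (∀ d hd, Derivable (K d hd) (D.lab d hd)) →
    C (H.replace e (D.fill (Tp.div N D) K))
  times_left : ∀ {G : Hypergraph (Tp Pr) n} (e : G.E) (F : Hypergraph (Tp Pr) (G.rk e)),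
    G.lab e = Tp.times F → C (G.replace e F) → C G

theorem leftClosed_derivable {n : ℕ} (A : Tp Pr n) : LeftClosed fun H => Derivable H A :=
  ⟨.iso, .div_left, .times_left⟩

/-- The inverse image of a left-closed set under grafting is left-closed. -/
theorem LeftClosed.graft {n : ℕ} {C : Hypergraph (Tp Pr) n → Prop} (hC : LeftClosed C)
    (S : Shape n) (s : S.E) (K : (e : S.E) → e ≠ s → Hypergraph (Tp Pr) (S.rk e)) :
    LeftClosed fun X => C (S.graft s X K) where
  iso h hX := hC.iso (S.graft_congr s h fun _ _ => .refl _) hX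
  div_left e N D J he hX hJ :=
    hC.iso (S.graft_replace s _ K e _) (hC.div_left (Sum.inl e) N D J he hX hJ)
  times_left {X} e F he hX :=
    hC.times_left (G := S.graft s X K) (Sum.inl e) F he (hC.iso (S.graft_replace s _ K e F).symm hX)

/-- The interpretation of a representative of a type as a set of hypergraphs. The hypergraphs
occurring in the type only enter through their shapes and the interpretations of their labels. In
the case of `×`, the least left-closed set is given as the intersection of all left-closed sets that
contain the generators. -/
def PreTp.Sem : {n : ℕ} → PreTp Pr n → Hypergraph (Tp Pr) n → Prop
  | _, .prim p => fun H => Derivable H (Tp.prim p)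
  | _, .div N S dollar hd lab => fun F =>
      ∀ K : (e : S.E) → e ≠ dollar → Hypergraph (Tp Pr) (S.rk e),
        (∀ e he, (lab e he).Sem (K e he)) → N.Sem (S.graft dollar (hd ▸ F) K)
  | n, .times S lab => fun H =>
      ∀ C : Hypergraph (Tp Pr) n → Prop, LeftClosed C →
        (∀ K : (e : S.E) → Hypergraph (Tp Pr) (S.rk e), (∀ e, (lab e).Sem (K e)) →
          C (Hypergraph.replaceAll ⟨S, fun e => Quotient.mk _ (lab e)⟩ K)) → C H

theorem PreTp.sem_leftClosed {n : ℕ} (A : PreTp Pr n) : LeftClosed A.Sem := by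
  induction A with
  | prim p => exact leftClosed_derivable _
  | div N S dollar hd lab ihN ih =>
    subst hd
    refine ⟨fun h hF K hK => ?_, fun e M D J he hF hJ K hK => ?_, fun e F he hF K hK => ?_⟩
    · exact (ihN.graft S dollar K).iso h (hF K hK)
    · exact (ihN.graft S dollar K).div_left e M D J he (hF K hK) hJ
    · exact (ihN.graft S dollar K).times_left e F he (hF K hK)
  | times S lab ih =>
    refine ⟨fun h hF C hC hK => ?_, fun e M D J he hF hJ C hC hK => ?_, fun e F he hF C hC hK => ?_⟩
    · exact hC.iso h (hF C hC hK)
    · exact hC.div_left e M D J he (hF C hC hK) hJ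
    · exact hC.times_left e F he (hF C hC hK)

/-! ### Invariance under identification of types -/

/-- Representatives of the same type have the same interpretation. In the induction the ranks of the
two representatives are different expressions, which is why two heterogeneously equal hypergraphs
appear. -/
theorem PreTp.Same.sem_iff {m n : ℕ} {A : PreTp Pr m} {B : PreTp Pr n} (h : PreTp.Same A B) :
    ∀ {H : Hypergraph (Tp Pr) m} {H' : Hypergraph (Tp Pr) n}, m = n → HEq H H' →
      (A.Sem H ↔ B.Sem H') := by
  induction h with
  | prim p =>
    rintro H H' - h
    rw [eq_of_heq h]
  | div N N' S S' dollar dollar' hd hd' lab lab' f hN hdollar hlab ihN ih =>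
    rintro H H' rfl h
    obtain rfl := eq_of_heq h
    have hne : ∀ e, e ≠ dollar → f.onE e ≠ dollar' := fun e h h' =>
      h (f.onE.injective (h'.trans hdollar.symm))
    have hH : HEq (hd.symm ▸ H : Hypergraph (Tp Pr) (S.rk dollar))
        (hd'.symm ▸ H : Hypergraph (Tp Pr) (S'.rk dollar')) :=
      (eqRec_heq _ _).trans (eqRec_heq _ _).symm
    constructor
    · intro hF K' hK'
      let K (e) (h : e ≠ dollar) : Hypergraph (Tp Pr) (S.rk e) := f.rk_eq e ▸ K' (f.onE e) (hne e h)
      have hKK : ∀ e h h', HEq (K e h) (K' (f.onE e) h') := fun e h h' => eqRec_heq _ _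
      refine N'.sem_leftClosed.iso (Shape.graft_isomorphic_of_shape f hdollar hH hKK) ?_
      exact (ihN rfl HEq.rfl).1 (hF K fun e h =>
        (ih e h (hne e h) (f.rk_eq e).symm (hKK e h _)).2 (hK' _ _))
    · intro hF K hK
      have : ∃ K' : (e : S'.E) → e ≠ dollar' → Hypergraph (Tp Pr) (S'.rk e),
          ∀ e h h', HEq (K e h) (K' (f.onE e) h') := by
        have hne' : ∀ e, e ≠ dollar' → f.onE.symm e ≠ dollar := fun e h h' =>
          h (by rw [← hdollar, ← h', Equiv.apply_symm_apply])
        refine ⟨fun e h => f.symm.rk_eq e ▸ K (f.onE.symm e) (hne' e h), fun e h h' => ?_⟩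
        refine HEq.trans ?_ (eqRec_heq _ _).symm
        have key : ∀ e' (h' : e' ≠ dollar), e = e' → HEq (K e h) (K e' h') := by
          rintro e' h' rfl; rfl
        exact key _ _ (f.onE.symm_apply_apply e).symm
      obtain ⟨K', hKK⟩ := this
      refine N.sem_leftClosed.iso (Shape.graft_isomorphic_of_shape f hdollar hH hKK).symm ?_
      refine (ihN rfl HEq.rfl).2 (hF K' fun e' h' => ?_)
      obtain ⟨e, rfl⟩ := f.onE.surjective e'
      have h : e ≠ dollar := fun h => h' ((congrArg _ h).trans hdollar)
      exact (ih e h h' (f.rk_eq e).symm (hKK e h h')).1 (hK e h)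
  | times S S' lab lab' f hlab ih =>
    rintro H H' - h
    obtain rfl := eq_of_heq h
    constructor
    · intro hH C hC hgen
      refine hH C hC fun K hK => ?_
      have : ∃ K' : (e : S'.E) → Hypergraph (Tp Pr) (S'.rk e),
          ∀ e, HEq (K e) (K' (f.onE e)) := by
        refine ⟨fun e => f.symm.rk_eq e ▸ K (f.onE.symm e), fun e => ?_⟩
        refine HEq.trans ?_ (eqRec_heq _ _).symm
        exact congr_arg_heq K (f.onE.symm_apply_apply e).symm
      obtain ⟨K', hKK⟩ := this
      refine hC.iso (Hypergraph.replaceAll_isomorphic_of_shape (M := ⟨S', _⟩) (M' := ⟨S, _⟩)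
        f.symm K' K fun e' => ?_) (hgen K' fun e' => ?_)
      · obtain ⟨e, rfl⟩ := f.onE.surjective e'
        exact (hKK e).symm.trans (congr_arg_heq K (f.onE.symm_apply_apply e).symm)
      · obtain ⟨e, rfl⟩ := f.onE.surjective e'
        exact (ih e (f.rk_eq e).symm (hKK e)).1 (hK e)
    · intro hH C hC hgen
      refine hH C hC fun K' hK' => ?_
      let K (e) : Hypergraph (Tp Pr) (S.rk e) := f.rk_eq e ▸ K' (f.onE e)
      have hKK : ∀ e, HEq (K e) (K' (f.onE e)) := fun e => eqRec_heq _ _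
      refine hC.iso (Hypergraph.replaceAll_isomorphic_of_shape (M := ⟨S, _⟩) (M' := ⟨S', _⟩)
        f K K' hKK) (hgen K fun e => ?_)
      exact (ih e (f.rk_eq e).symm (hKK e)).2 (hK' _)

/-! ### Interpretations against derivability -/

theorem PreTp.same_out {n : ℕ} (A : PreTp Pr n) :
    PreTp.Same A (Quotient.out (Quotient.mk _ A : Tp Pr n)) :=
  PreTp.Same.symm (Quotient.mk_out A)

/-- The interpretation of `A` contains `A^•` and consists of antecedents of `A`. The two
statements are proved together, since `÷` is contravariant in the labels of its denominator. -/
theorem PreTp.sem_handle_and_derivable_of_sem {n : ℕ} (A : PreTp Pr n) :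
    A.Sem (.handle (Quotient.mk _ A)) ∧ ∀ H, A.Sem H → Derivable H (Quotient.mk _ A) := by
  induction A with
  | prim p => exact ⟨.ax p, fun _ h => h⟩
  | div N S dollar hd lab ihN ih =>
    subst hd
    let D : DollarGraph (Tp Pr) _ := ⟨S, dollar, fun e h => Quotient.mk _ (lab e h)⟩
    have hT : (Quotient.mk _ (.div N S dollar rfl lab) : Tp Pr _) =
        Tp.div (Quotient.mk _ N) D := Quotient.sound <|
      .div _ _ _ _ _ _ _ _ _ _ (.refl S) (PreTp.same_out N) rfl
        fun e h _ => PreTp.same_out (lab e h)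
    rw [hT]
    constructor
    · -- `N^•` lies in the interpretation of `N`; apply `(÷ →)` to its only hyperedge.
      intro K hK
      refine N.sem_leftClosed.iso ((Hypergraph.handle_replace _ _).trans
        (D.fill_isomorphic_graft _ K)) (N.sem_leftClosed.div_left _ _ D K rfl ihN.1 ?_)
      exact fun d hd => (ih d hd).2 _ (hK d hd)
    · -- Grafting the handles of the labels of `D` turns the graft into `D[$/F]`.
      intro F hF
      refine .div_right _ D F (ihN.2 _ ?_)
      exact N.sem_leftClosed.iso (D.plug_isomorphic_graft F).symm (hF _ fun e he => (ih e he).1)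
  | times S lab ih =>
    let M : Hypergraph (Tp Pr) _ := ⟨S, fun e => Quotient.mk _ (lab e)⟩
    have hT : (Quotient.mk _ (.times S lab) : Tp Pr _) = Tp.times M := Quotient.sound <|
      .times _ _ _ _ (.refl S) fun e => PreTp.same_out (lab e)
    rw [hT]
    constructor
    · -- `M` itself is a generator, and `(× →)` leads from `M` to `×(M)^•`.
      intro C hC hgen
      refine hC.times_left () M rfl (hC.iso (Hypergraph.handle_replace _ M).symm ?_)
      exact hC.iso M.replaceAll_handle (hgen _ fun e => (ih e).1)
    · intro H hH
      exact hH _ (leftClosed_derivable _) fun K hK => .times_right M K fun e => (ih e).2 _ (hK e)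

/-- The interpretation of a type, which is that of any of its representatives (`Tp.sem_mk`). -/
noncomputable def Tp.Sem {n : ℕ} (A : Tp Pr n) : Hypergraph (Tp Pr) n → Prop :=
  (Quotient.out A).Sem

theorem Tp.sem_mk {n : ℕ} (A : PreTp Pr n) (H : Hypergraph (Tp Pr) n) :
    Tp.Sem (Quotient.mk _ A) H ↔ A.Sem H :=
  (PreTp.same_out A).symm.sem_iff rfl HEq.rfl

theorem Tp.sem_handle {n : ℕ} (A : Tp Pr n) : A.Sem (.handle A) := by
  have h := (Quotient.out A).sem_handle_and_derivable_of_sem.1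
  have hA : (Quotient.mk _ (Quotient.out A) : Tp Pr n) = A := Quotient.out_eq A
  rwa [hA] at h

theorem Tp.derivable_of_sem {n : ℕ} {A : Tp Pr n} {H : Hypergraph (Tp Pr) n} (h : A.Sem H) :
    Derivable H A := by
  have h' := (Quotient.out A).sem_handle_and_derivable_of_sem.2 H h
  have hA : (Quotient.mk _ (Quotient.out A) : Tp Pr n) = A := Quotient.out_eq A
  rwa [hA] at h'

theorem Tp.sem_leftClosed {n : ℕ} (A : Tp Pr n) : LeftClosed A.Sem :=
  (Quotient.out A).sem_leftClosed

theorem Tp.sem_div {n : ℕ} (N : Tp Pr n) (D : DollarGraph (Tp Pr) n)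
    (F : Hypergraph (Tp Pr) (D.rk D.dollar)) :
    (Tp.div N D).Sem F ↔ ∀ K : (e : D.E) → e ≠ D.dollar → Hypergraph (Tp Pr) (D.rk e),
      (∀ e he, (D.lab e he).Sem (K e he)) → N.Sem (D.graft D.dollar F K) :=
  Tp.sem_mk _ _

theorem Tp.sem_times {n : ℕ} (M : Hypergraph (Tp Pr) n) (H : Hypergraph (Tp Pr) n) :
    (Tp.times M).Sem H ↔ ∀ C : Hypergraph (Tp Pr) n → Prop, LeftClosed C →
      (∀ K : (e : M.E) → Hypergraph (Tp Pr) (M.rk e), (∀ e, (M.lab e).Sem (K e)) →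
        C (M.replaceAll K)) → C H :=
  Tp.sem_mk _ _

/-! ### Soundness -/

/-- Soundness of the calculus. The quantification over all `J` in the interpretations is what the
induction needs: for `(→ ×)` and for the side premises of `(÷ →)`, the replacement made in the
conclusion is distributed to the components. -/
theorem Derivable.sem_replaceAll {n : ℕ} {G : Hypergraph (Tp Pr) n} {B : Tp Pr n}
    (h : Derivable G B) (J : (e : G.E) → Hypergraph (Tp Pr) (G.rk e))
    (hJ : ∀ e, (G.lab e).Sem (J e)) : B.Sem (G.replaceAll J) := by
  induction h with
  | @iso n H H' A hiso _ ih =>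
    obtain ⟨f, hf⟩ := hiso
    let I (e) : Hypergraph (Tp Pr) (H.rk e) := f.rk_eq e ▸ J (f.onE e)
    have hIJ : ∀ e, HEq (I e) (J (f.onE e)) := fun e => eqRec_heq _ _
    refine A.sem_leftClosed.iso (Hypergraph.replaceAll_isomorphic_of_shape f I J hIJ)
      (ih I fun e => ?_)
    -- Labels and components of corresponding hyperedges are only heterogeneously equal.
    have key : ∀ {k l} (a : Tp Pr k) (b : Tp Pr l) (X : Hypergraph (Tp Pr) k)
        (Y : Hypergraph (Tp Pr) l), k = l → HEq a b → HEq X Y → b.Sem Y → a.Sem X := by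
      rintro k l a b X Y rfl hab hXY h
      rwa [eq_of_heq hab, eq_of_heq hXY]
    exact key _ _ _ _ (f.rk_eq e).symm (hf e) (hIJ e) (hJ _)
  | ax p => exact (Tp.sem_leftClosed _).iso (Hypergraph.handle_replaceAll _ J).symm (hJ ())
  | @div_left m H A e N D K he _ _ ihH ihK =>
    refine A.sem_leftClosed.iso ((H.toDollar e).plug_replaceAll _ J).symm ?_
    let I (e') (h : e' ≠ e) : Hypergraph (Tp Pr) (H.rk e') := J (.inl ⟨e', h⟩)
    let X : Hypergraph (Tp Pr) (H.rk e) :=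
      (D.fill (Tp.div N D) K).replaceAll fun f => J (.inr f)
    have hX : N.Sem X := by
      -- The hyperedge labelled `N ÷ D` is replaced by a member of its interpretation, and each
      -- `K d` turns into a member of that of the label of `d`.
      refine N.sem_leftClosed.iso (D.fill_replaceAll _ K _).symm ?_
      refine (Tp.sem_div N D _).1 (hJ (.inr ⟨.inr (), ()⟩)) _ fun d hd => ?_
      exact ihK d hd _ fun f => hJ (.inr ⟨.inl ⟨d, hd⟩, f⟩)
    obtain ⟨I', hI, hI'⟩ := H.exists_extend e X I
    have h := ihH I' fun e' => by
      by_cases h : e' = e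
      · subst h
        rw [hI, he]
        exact hX
      · rw [hI' e' h]
        exact hJ (.inl ⟨e', h⟩)
    have h' := A.sem_leftClosed.iso (H.graft_isomorphic_replaceAll e I').symm h
    rw [hI, show (fun e' (_ : e' ≠ e) => I' e') = I from funext fun e' => funext (hI' e')] at h'
    exact h'
  | div_right N D F _ ih =>
    refine (Tp.sem_div N D _).2 fun K hK => ?_
    refine N.sem_leftClosed.iso (D.plug_replaceAll F fun
      | .inl e => K e.1 e.2
      | .inr f => J f) (ih _ ?_)
    rintro (e | f)
    · exact hK e.1 e.2
    · exact hJ f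
  | @times_left m G A e F he _ ih =>
    refine A.sem_leftClosed.iso (G.graft_isomorphic_replaceAll e J) ?_
    have h := hJ e
    rw [he] at h
    -- The hypergraphs that may be grafted at `e` form a left-closed set, so it suffices to treat
    -- the generators of the interpretation of `×(F)`.
    refine (Tp.sem_times F _).1 h _ (A.sem_leftClosed.graft G.toShape e fun e _ => J e)
      fun K hK => ?_
    refine A.sem_leftClosed.iso ((G.toDollar e).plug_replaceAll F fun
      | .inl e' => J e'.1
      | .inr f => K f) (ih _ ?_)
    rintro (e' | f)
    · exact hJ e'.1
    · exact hK f
  | times_right M K _ ih =>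
    refine (Tp.sem_times M _).2 fun C hC hgen => ?_
    exact hC.iso (M.replaceAll_replaceAll K J).symm
      (hgen _ fun e => ih e _ fun f => hJ ⟨e, f⟩)

end Semantics

end HLWI

theorem mainTheorem7 {Pr : ℕ → Type u} {n : ℕ} (G : HLWI.Hypergraph (HLWI.Tp Pr) n)
    (B : HLWI.Tp Pr n) (e₀ : G.E) (A : HLWI.Tp Pr (G.rk e₀))
    (H : HLWI.Hypergraph (HLWI.Tp Pr) (G.rk e₀))
    (hlab : G.lab e₀ = A) (hH : HLWI.Derivable H A) (hG : HLWI.Derivable G B) :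
    HLWI.Derivable (G.replace e₀ H) B := by
  have hA : A.Sem H := A.sem_leftClosed.iso H.replaceAll_handle
    (hH.sem_replaceAll _ fun e => (H.lab e).sem_handle)
  obtain ⟨J, hJ, hJ'⟩ := G.exists_extend e₀ H fun e _ => .handle (G.lab e)
  have hB : B.Sem (G.replaceAll J) := hG.sem_replaceAll J fun e => by
    by_cases h : e = e₀
    · subst h
      rwa [hJ, hlab]
    · rw [hJ' e h]
      exact (G.lab e).sem_handle
  refine .iso ((G.graft_isomorphic_replaceAll e₀ J).symm.trans ?_) (HLWI.Tp.derivable_of_sem hB)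
  rw [hJ, show (fun e (_ : e ≠ e₀) => J e) = fun e _ => .handle (G.lab e) from
    funext fun e => funext (hJ' e)]
  exact ((G.toDollar e₀).plug_isomorphic_graft H).symm
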